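/- **Model.** There are $n$ parties, one of which is the designated broadcaster $L$ with an input value from a set $V$ with at least two elements. At most $f$ parties are Byzantine, the others are honest. Each party has a local clock without drift that starts at $0$ when the party starts the protocol; honest parties start at most $\sigma$ apart (clock skew $\sigma$). Protocols are deterministic and use perfect digital signatures with a PKI: what an honest party sends and commits at a given local time is a function of its identity, its input (the broadcaster only), its local time and the messages received so far with their senders and local reception times, and it can include another party's signature only if it has received it. Byzantine parties collude and behave arbitrarily, except that they can use a signature of an honest party only if one of them has received it. An execution has *delay bound* $d$ if every message between honest parties has delay at most $d$; delays of messages from or to Byzantine parties are arbitrary, possibly infinite. Within one execution all delays are bounded below by some positive number (depending on the execution). A message that arrives before its recipient has started is received when the recipient starts. A protocol is a *Byzantine reliable broadcast* (BRB) protocol resilient to $f$ faults, for the known delay bound $\Delta$ and clock skew $\sigma$, if in all executions with at most $f$ Byzantine parties, delay bound $\Delta$ and clock skew at most $\sigma$: - (Agreement) any two values committed by honest parties are equal; - (Validity) if the broadcaster is honest, all honest parties commit its value; - (Termination) if some honest party commits a value, then all honest parties commit a value. (Parties are not required to halt; requiring it in addition only shrinks the class of protocols.) For $0<\delta\le\Delta$,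 a protocol has *good-case latency* $T$ under actual delay bound $\delta$ if, in all executions with at most $f$ Byzantine parties, delay bound $\delta$, clock skew at most $\sigma$ and honest broadcaster, all honest parties commit within time $T$ since the broadcaster starts. **Theorem.** Let $n\ge 4$, $f>n/3$, $0<\delta\le\Delta$, and consider unsynchronized start with clock skew $\sigma=0.5\,\delta$. If a Byzantine reliable broadcast protocol resilient to $f$ faults (for delay bound $\Delta$ and clock skew $\sigma$; the protocol may depend on $n,f,\Delta,\delta$) has good-case latency $T$ under actual delay bound $\delta$, then $$T\;\ge\;\Delta+1.5\,\delta .$$ -/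

import Mathlib

namespace BRB

/-- Messages exchanged by `n` parties: symbolic terms built from unsigned data by pairing and by
perfect digital signatures, where `sign i m` is the message `m` signed by party `i`. -/
inductive Msg (n : ℕ) (D : Type*) where
  | data (d : D) : Msg n D
  | pair (a b : Msg n D) : Msg n D
  | sign (i : Fin n) (m : Msg n D) : Msg n D

/-- `Carries k x m`: the signature of party `k` on the message `x` occurs inside the message `m`. -/
def Carries {n : ℕ} {D : Type*} (k : Fin n) (x : Msg n D) : Msg n D → Prop
  | .data _ => False
  | .pair a b => Carries k x a ∨ Carries k x b
  | .sign i m => (i = k ∧ m = x) ∨ Carries k x m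

/-- What a party receives: the triple `(τ, j, m)` records that the message `m` from party `j` is
received at local time `τ`. -/
abbrev View (n : ℕ) (D : Type*) := Set (ℝ × Fin n × Msg n D)

/-- The part of a view received up to and including local time `τ`. -/
def View.upTo {n : ℕ} {D : Type*} (h : View n D) (τ : ℝ) : View n D := {x ∈ h | x.1 ≤ τ}

/-- A deterministic authenticated protocol for `n` parties. What party `i` does at local time `τ`
is a function of its initial state (its identity and its input, which is `some v` for the
broadcaster and `none` for everybody else), of `τ`, and of the messages it has received by then:
* `send i inp τ h j` is the set of messages it sends to party `j` at local time `τ`;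
* `commit i inp τ h` is the value that it commits at local time `τ`, if any.

The protocol cannot forge: a signature of another party is only sent if it has been received. -/
structure Protocol (n : ℕ) (V D : Type*) where
  send : Fin n → Option V → ℝ → View n D → Fin n → Set (Msg n D)
  commit : Fin n → Option V → ℝ → View n D → Option V
  no_forgery : ∀ i inp τ h j, ∀ m ∈ send i inp τ h j, ∀ k x, k ≠ i → Carries k x m →
    ∃ y ∈ h, Carries k x y.2.2

/-- The data of a run, before any rule is imposed: the set of honest parties (the others are
Byzantine), the input of the broadcaster, the global time at which each party starts its local
clock, the set `sent i t j` of the messages that `i` sends to `j` at global time `t`, and the delay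
`delay i t j m` (possibly infinite) of the message `m` sent by `i` to `j` at global time `t`. -/
structure Run (n : ℕ) (V D : Type*) where
  honest : Finset (Fin n)
  input : V
  start : Fin n → ℝ
  sent : Fin n → ℝ → Fin n → Set (Msg n D)
  delay : Fin n → ℝ → Fin n → Msg n D → WithTop ℝ

variable {n : ℕ} {V D : Type*}

/-- `E.Delivered i j m r`: a message `m` from `i` arrives at `j` at global time `r`. -/
def Run.Delivered (E : Run n V D) (i j : Fin n) (m : Msg n D) (r : ℝ) : Prop :=
  ∃ t d : ℝ, m ∈ E.sent i t j ∧ E.delay i t j m = (d : WithTop ℝ) ∧ r = t + d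

/-- The messages received by party `j`, with local reception times. A message that arrives before
`j` has started waits, and is received when `j` starts, at local time `0`. -/
def Run.view (E : Run n V D) (j : Fin n) : View n D :=
  {x | ∃ r, E.Delivered x.2.1 j x.2.2 r ∧ x.1 = max 0 (r - E.start j)}

/-- The input of party `i` when the designated broadcaster is `L`. -/
def Run.inputOf (E : Run n V D) (L i : Fin n) : Option V := if i = L then some E.input else none

/-- `E` is an execution of the protocol `P` with designated broadcaster `L` and at most `f`
Byzantine parties, with message delay bound `d` and clock skew at most `σ`. -/
structure IsExecution (P : Protocol n V D) (L : Fin n) (f : ℕ) (d σ : ℝ) (E : Run n V D) :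
    Prop where
  /-- At most `f` parties are Byzantine. -/
  faults : E.honestᶜ.card ≤ f
  /-- No honest party starts before global time `0`. -/
  start_nonneg : ∀ i ∈ E.honest, 0 ≤ E.start i
  /-- Honest parties start at most `σ` apart. Clocks do not drift. -/
  skew : ∀ i ∈ E.honest, ∀ j ∈ E.honest, |E.start i - E.start j| ≤ σ
  /-- Message delays between honest parties are at most `d`. -/
  delay_le : ∀ i ∈ E.honest, ∀ j ∈ E.honest, ∀ t m, E.delay i t j m ≤ (d : WithTop ℝ)
  /-- In every single execution the delays are bounded away from `0`, so that no message can be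
  its own cause. There is no bound on the delays, apart from this one, if one of the two parties
  is Byzantine. -/
  delay_pos : ∃ ε : ℝ, 0 < ε ∧ ∀ i t j m, (ε : WithTop ℝ) ≤ E.delay i t j m
  /-- Honest parties follow the protocol from the moment at which they start. -/
  honest_send : ∀ i ∈ E.honest, ∀ t j m, m ∈ E.sent i t j ↔
    E.start i ≤ t ∧
      m ∈ P.send i (E.inputOf L i) (t - E.start i) ((E.view i).upTo (t - E.start i)) j
  /-- Byzantine parties may send anything from global time `0` on, except that they can use a
  signature of an honest party only if one of them has received it. -/
  byzantine_send : ∀ i ∉ E.honest, ∀ t j, ∀ m ∈ E.sent i t j, 0 ≤ t ∧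
    ∀ k ∈ E.honest, ∀ x, Carries k x m →
      ∃ b ∉ E.honest, ∃ s m' r, E.Delivered s b m' r ∧ r ≤ t ∧ Carries k x m'

/-- In the run `E` of `P`, the party `i` commits the value `v` at global time `t`
(meaningful for honest `i`). -/
def Run.CommitsAt (E : Run n V D) (P : Protocol n V D) (L i : Fin n) (v : V) (t : ℝ) : Prop :=
  E.start i ≤ t ∧
    P.commit i (E.inputOf L i) (t - E.start i) ((E.view i).upTo (t - E.start i)) = some v

/-- `P` is a Byzantine reliable broadcast protocol with designated broadcaster `L`, resilient to `f`
Byzantine parties, for message delays at most `Δ` and clock skew at most `σ`. -/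
structure IsReliableBroadcast (P : Protocol n V D) (L : Fin n) (f : ℕ) (Δ σ : ℝ) : Prop where
  /-- Any two values committed by honest parties are equal. -/
  agreement : ∀ E, IsExecution P L f Δ σ E → ∀ i ∈ E.honest, ∀ j ∈ E.honest, ∀ v w s t,
    E.CommitsAt P L i v s → E.CommitsAt P L j w t → v = w
  /-- If the broadcaster is honest, then all honest parties commit its value. -/
  validity : ∀ E, IsExecution P L f Δ σ E → L ∈ E.honest →
    ∀ i ∈ E.honest, ∃ t, E.CommitsAt P L i E.input t
  /-- If some honest party commits, then all honest parties commit. -/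
  termination : ∀ E, IsExecution P L f Δ σ E →
    (∃ i ∈ E.honest, ∃ v t, E.CommitsAt P L i v t) →
    ∀ j ∈ E.honest, ∃ w t, E.CommitsAt P L j w t

/-- `P` has good-case latency `T` when the actual message delay bound is `δ` and the clock skew is
at most `σ`: in all executions with an honest broadcaster, all honest parties commit within time
`T` since the broadcaster starts. -/
def HasGoodCaseLatency (P : Protocol n V D) (L : Fin n) (f : ℕ) (δ σ T : ℝ) : Prop :=
  ∀ E, IsExecution P L f δ σ E → L ∈ E.honest →
    ∀ i ∈ E.honest, ∃ v t, E.CommitsAt P L i v t ∧ t ≤ E.start L + T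

end BRB

namespace BRB

/-! This is a split-brain argument. The parties are divided into fewer than `f` two-faced ones,
among them the broadcaster, and two sides of at most `f` parties. In the split system each two-faced
party runs two copies of the protocol, one per side, with different broadcaster values. Messages
within a side take `δ`; messages between sides take `Δ + s` to the two apexes and `Δ - s` to the
others, where `2 * s < δ`.

The split system is realised by two executions, according to which side starts `s` earlier. If side
`b₀` is early, its apex gets the late side's messages after `Δ + s - s = Δ`, and the ordinary
parties of the late side get the early side's after `Δ - s + s = Δ`. Only the late apex would see a
larger delay, and it is made Byzantine with the two-faced parties. Local views are the same in both
executions (`IsSplit.view_splitRun`).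

On the other hand, before time `Δ + δ + s` the apex of side `b` cannot tell the split system from a
run with honest broadcaster, delays `δ`, and the other side Byzantine (`IsSplit.upTo_eq_isGood`). If
`T < Δ + δ + s`, it therefore commits the value of its side. By termination and agreement, a
non-apex party `c`, honest in both split executions, commits `val b₀` in the execution where `b₀` is
early. As its view is the same in both, it commits both values in one execution, against agreement.
Finally `s` tends to `δ / 2`. -/

/-- A time-indexed recursion in which the value at time `t` depends only on the values up to time
`t - ε`, and on nothing at negative times, has a solution. -/
theorem exists_eq_of_causal {X : Type*} [Nonempty X] {ε : ℝ} (hε : 0 < ε) (Φ : (ℝ → X) → ℝ → X)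
    (h0 : ∀ S S' t, t < 0 → Φ S t = Φ S' t)
    (hc : ∀ S S' t, (∀ t' ≤ t - ε, S t' = S' t') → Φ S t = Φ S' t) :
    ∃ S, ∀ t, S t = Φ S t := by
  obtain ⟨x⟩ := ‹Nonempty X›
  let A : ℕ → ℝ → X := fun k => Φ^[k] (fun _ => x)
  have hA : ∀ k, A (k + 1) = Φ (A k) := fun k => Function.iterate_succ_apply' Φ k _
  -- Causality settles the iterates on one more interval of length `ε` at each application of `Φ`.
  have step : ∀ k : ℕ, ∀ t < k * ε, A (k + 1) t = A (k + 2) t := by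
    intro k
    induction k with
    | zero =>
      intro t ht
      rw [hA, hA]
      exact h0 _ _ _ (by simpa using ht)
    | succ k ih =>
      intro t ht
      rw [hA (k + 1), hA (k + 2)]
      refine hc _ _ _ fun t' ht' => ih t' ?_
      push_cast at ht
      linarith
  have stable : ∀ k l : ℕ, k ≤ l → ∀ t < k * ε, A (k + 1) t = A (l + 1) t := by
    intro k l hkl
    induction l, hkl using Nat.le_induction with
    | base => exact fun _ _ => rfl
    | succ l hkl ih =>
      intro t ht
      refine (ih t ht).trans (step l t (ht.trans_le ?_))
      have : (k : ℝ) ≤ l := by exact_mod_cast hkl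
      gcongr
  have hN : ∀ t : ℝ, t < (⌊t / ε⌋₊ + 1 : ℕ) * ε := fun t => by
    rw [← div_lt_iff₀ hε]
    exact_mod_cast Nat.lt_floor_add_one (t / ε)
  have key : ∀ (k : ℕ) (t : ℝ), t < k * ε → A (⌊t / ε⌋₊ + 1 + 1) t = A (k + 1) t := by
    intro k t ht
    rcases le_total k (⌊t / ε⌋₊ + 1) with h | h
    · exact (stable _ _ h t ht).symm
    · exact stable _ _ h t (hN t)
  refine ⟨fun t => A (⌊t / ε⌋₊ + 1 + 1) t, fun t => ?_⟩
  dsimp only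
  rw [hA]
  refine hc _ _ _ fun t' ht' => (key _ t' ?_).symm
  have := hN t
  push_cast at this ⊢
  linarith

/-! ### The split system -/

/-- The parties and the times of the split-brain argument. The parties with `home i = none`, among
them the broadcaster, are two-faced; the others live on one of two sides. On each side one party
`apex b` is distinguished. -/
structure Scenario (n : ℕ) (V : Type*) (L : Fin n) (f : ℕ) (Δ δ s : ℝ) where
  home : Fin n → Option Bool
  apex : Bool → Fin n
  val : Bool → V
  home_broadcaster : home L = none
  home_apex : ∀ b, home (apex b) = some b
  card_none : (Finset.univ.filter fun i => home i = none).card + 1 ≤ f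
  card_side : ∀ b, (Finset.univ.filter fun i => home i = some b).card ≤ f
  pos : 0 < δ
  le : δ ≤ Δ
  nonneg : 0 ≤ s
  two_mul_lt : 2 * s < δ

namespace Scenario

variable {n : ℕ} {V D : Type*} {L : Fin n} {f : ℕ} {Δ δ s : ℝ} (C : Scenario n V L f Δ δ s)

/-- The starting times on each side: the broadcaster starts `δ / 2` before all others. -/
noncomputable def clock (_ : Scenario n V L f Δ δ s) (i : Fin n) : ℝ := if i = L then 0 else δ / 2

/-- The time that messages from the other side need to reach `j`. -/
noncomputable def lag (j : Fin n) : ℝ := if ∃ b, j = C.apex b then Δ + s else Δ - s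

/-- The time that messages from side `b'` need to reach the party `j` on side `b`. -/
noncomputable def off (b' b : Bool) (j : Fin n) : ℝ := if b' = b then δ else C.lag j

/-- The input of party `i` on side `b`. -/
def inp (i : Fin n) (b : Bool) : Option V := if i = L then some (C.val b) else none

/-- The view of party `j` on side `b`, if the parties `i` on side `b'` send `S t i b' j` to `j`. -/
def splitView (S : ℝ → Fin n → Bool → Fin n → Set (Msg n D)) (j : Fin n) (b : Bool) : View n D :=
  {x | ∃ b', (b' = b ∨ (C.home x.2.1 = some b' ∧ C.home j = some b)) ∧
    x.2.2 ∈ S (x.1 + C.clock j - C.off b' b j) x.2.1 b' j}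

/-- On both sides all parties follow the protocol. -/
def IsSplit (P : Protocol n V D) (S : ℝ → Fin n → Bool → Fin n → Set (Msg n D)) : Prop :=
  ∀ t i b j m, m ∈ S t i b j ↔ C.home i ≠ some (!b) ∧ C.clock i ≤ t ∧
    m ∈ P.send i (C.inp i b) (t - C.clock i) ((C.splitView S i b).upTo (t - C.clock i)) j

theorem clock_nonneg (i : Fin n) : 0 ≤ C.clock i := by
  have := C.pos
  unfold clock; split_ifs <;> linarith

theorem clock_le (i : Fin n) : C.clock i ≤ δ / 2 := by
  have := C.pos
  unfold clock; split_ifs <;> linarith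

theorem clock_of_home {i : Fin n} {b : Bool} (h : C.home i = some b) : C.clock i = δ / 2 := by
  refine if_neg ?_
  rintro rfl
  simp [C.home_broadcaster] at h

theorem inp_of_home {i : Fin n} {b b' : Bool} (h : C.home i = some b) : C.inp i b' = none := by
  refine if_neg ?_
  rintro rfl
  simp [C.home_broadcaster] at h

theorem le_lag (j : Fin n) : Δ - s ≤ C.lag j := by
  have := C.nonneg
  unfold lag; split_ifs <;> linarith

theorem lag_le (j : Fin n) : C.lag j ≤ Δ + s := by
  have := C.nonneg
  unfold lag; split_ifs <;> linarith

theorem lag_apex (b : Bool) : C.lag (C.apex b) = Δ + s := if_pos ⟨b, rfl⟩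

theorem lag_of_ne {j : Fin n} {b : Bool} (h : C.home j = some b) (hj : j ≠ C.apex b) :
    C.lag j = Δ - s := by
  refine if_neg ?_
  rintro ⟨b', rfl⟩
  rw [C.home_apex] at h
  simp only [Option.some.injEq] at h
  exact hj (h ▸ rfl)

/-- Since `Δ - s > δ / 2`, the recursion defining the split system is causal with step `δ / 2`, and
no message arrives before its recipient has started. -/
theorem half_le_off (b' b : Bool) (j : Fin n) : δ / 2 ≤ C.off b' b j := by
  have := C.pos; have := C.le; have := C.two_mul_lt; have := C.le_lag j
  unfold off; split_ifs <;> linarith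

theorem exists_isSplit (P : Protocol n V D) : ∃ S, C.IsSplit P S := by
  have hpos := C.pos
  obtain ⟨S, hS⟩ := exists_eq_of_causal (X := Fin n → Bool → Fin n → Set (Msg n D))
    (half_pos hpos) (fun S t i b j => {m | C.home i ≠ some (!b) ∧ C.clock i ≤ t ∧
      m ∈ P.send i (C.inp i b) (t - C.clock i) ((C.splitView S i b).upTo (t - C.clock i)) j})
    (by
      intro S S' t ht
      funext i b j
      have := C.clock_nonneg i
      ext m
      simp only [Set.mem_ofPred_eq]
      constructor <;> rintro ⟨-, h, -⟩ <;> linarith)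
    (by
      intro S S' t h
      funext i b j
      have : (C.splitView S i b).upTo (t - C.clock i) =
          (C.splitView S' i b).upTo (t - C.clock i) := by
        ext ⟨τ, k, m⟩
        refine and_congr_left fun hτ => exists_congr fun b' => and_congr_right fun _ => ?_
        have := C.half_le_off b' b i
        dsimp only at hτ ⊢
        rw [h _ (by linarith)]
      simp only [this])
  exact ⟨S, fun t i b j m => by rw [hS t]; rfl⟩

variable {C} {P : Protocol n V D} {S : ℝ → Fin n → Bool → Fin n → Set (Msg n D)}

theorem IsSplit.alive (hS : C.IsSplit P S) {t : ℝ} {i : Fin n} {b : Bool} {j : Fin n}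
    {m : Msg n D} (h : m ∈ S t i b j) : C.home i ≠ some (!b) := ((hS ..).1 h).1

theorem IsSplit.clock_le (hS : C.IsSplit P S) {t : ℝ} {i : Fin n} {b : Bool} {j : Fin n}
    {m : Msg n D} (h : m ∈ S t i b j) : C.clock i ≤ t := ((hS ..).1 h).2.1

theorem IsSplit.eq_of_home (hS : C.IsSplit P S) {t : ℝ} {i : Fin n} {b b' : Bool} {j : Fin n}
    {m : Msg n D} (h : m ∈ S t i b j) (hb : C.home i = some b') : b' = b := by
  have := hS.alive h
  rw [hb] at this
  cases b <;> cases b' <;> simp_all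

/-! ### The split run as a run with a Byzantine broadcaster -/

variable (C)

/-- The delay of the clock of side `b` in the run in which side `b₀` is first. -/
noncomputable def shift (_ : Scenario n V L f Δ δ s) (b₀ b : Bool) : ℝ := if b = b₀ then 0 else s

/-- The message delays in the run in which side `b₀` is first. -/
noncomputable def splitDelay (b₀ : Bool) (i j : Fin n) : ℝ :=
  (C.home i).elim δ fun b => (C.home j).elim δ fun b' =>
    C.off b b' j + C.shift b₀ b' - C.shift b₀ b

/-- The run in which side `b₀` is first, and in which the two-faced parties and the distinguished
party of the other side are Byzantine. -/
noncomputable def splitRun (S : ℝ → Fin n → Bool → Fin n → Set (Msg n D)) (b₀ : Bool) : Run n V D where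
  honest := Finset.univ.filter fun i => C.home i ≠ none ∧ i ≠ C.apex (!b₀)
  input := C.val b₀
  start i := (C.home i).elim 0 fun b => δ / 2 + C.shift b₀ b
  sent i t j := {m | ∃ b, (C.home j = some (!b) → C.home i ≠ none) ∧
    m ∈ S (t - C.shift b₀ b) i b j}
  delay i _ j _ := (C.splitDelay b₀ i j : ℝ)

theorem shift_nonneg (b₀ b : Bool) : 0 ≤ C.shift b₀ b := by
  have := C.nonneg
  unfold shift; split_ifs <;> linarith

theorem shift_le (b₀ b : Bool) : C.shift b₀ b ≤ s := by
  have := C.nonneg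
  unfold shift; split_ifs <;> linarith

theorem mem_honest_splitRun {b₀ : Bool} {i : Fin n} :
    i ∈ (C.splitRun S b₀).honest ↔ C.home i ≠ none ∧ i ≠ C.apex (!b₀) := by
  simp [splitRun]

theorem le_splitDelay (b₀ : Bool) (i j : Fin n) : min δ (Δ - 2 * s) ≤ C.splitDelay b₀ i j := by
  unfold splitDelay
  rcases C.home i with _ | b
  · exact min_le_left _ _
  rcases C.home j with _ | b'
  · exact min_le_left _ _
  simp only [Option.elim, off]
  split_ifs with h
  · subst h
    simp
  · have := C.le_lag j; have := C.shift_nonneg b₀ b'; have := C.shift_le b₀ b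
    exact (min_le_right _ _).trans (by linarith)

/-- Across sides, the shift of clocks turns the lags into `Δ` or `Δ - 2 * s`. The sole exception is
the apex of the late side, where the delay would be `Δ + 2 * s`. -/
theorem splitDelay_le {b₀ : Bool} {i j : Fin n} (hj : j ≠ C.apex (!b₀)) :
    C.splitDelay b₀ i j ≤ Δ := by
  have := C.le; have := C.lag_le j
  unfold splitDelay
  rcases C.home i with _ | b
  · exact C.le
  rcases hj' : C.home j with _ | b'
  · exact C.le
  simp only [Option.elim, off, shift]
  by_cases hb' : b' = b₀
  · split_ifs <;> first | linarith | simp_all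
  · have : b' = !b₀ := by cases b' <;> cases b₀ <;> simp_all
    subst this
    have := C.lag_of_ne hj' hj
    split_ifs <;> first | linarith | simp_all

variable {C}

/-- What is received in the split system is delivered in the run. -/
theorem IsSplit.delivered (hS : C.IsSplit P S) (b₀ : Bool) {j : Fin n} {b : Bool}
    (hj : C.home j ≠ some (!b)) {x : ℝ × Fin n × Msg n D} (hx : x ∈ C.splitView S j b) :
    (C.splitRun S b₀).Delivered x.2.1 j x.2.2 (x.1 + C.clock j + C.shift b₀ b) := by
  obtain ⟨τ, i, m⟩ := x
  obtain ⟨b', hb, hm⟩ := hx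
  dsimp only at hb hm ⊢
  refine ⟨τ + C.clock j - C.off b' b j + C.shift b₀ b', C.splitDelay b₀ i j, ⟨b', ?_, ?_⟩, rfl, ?_⟩
  · intro h
    rcases hb with rfl | hb
    · exact absurd h hj
    · simp [hb.1]
  · simpa using hm
  · unfold splitDelay
    rcases hi : C.home i with _ | c
    · have : b' = b := by simpa [hi] using hb
      subst this
      simp only [Option.elim, off, if_true]
      ring
    · obtain rfl := hS.eq_of_home hm hi
      rcases hj' : C.home j with _ | c'
      · have : c = b := by simpa [hj'] using hb
        subst this
        simp only [Option.elim, off, if_true]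
        ring
      · have : c' = b := by
          rw [hj'] at hj
          cases c' <;> cases b <;> simp_all
        subst this
        simp only [Option.elim]
        ring

/-- The shifts of sender and recipient are absorbed by the delay, so local reception times do not
reveal which side is first. -/
theorem IsSplit.view_splitRun (hS : C.IsSplit P S) (b₀ : Bool) {j : Fin n} {b : Bool}
    (hj : C.home j = some b) : (C.splitRun S b₀).view j = C.splitView S j b := by
  have hstart : (C.splitRun S b₀).start j = δ / 2 + C.shift b₀ b := by simp [splitRun, hj]
  have hclock := C.clock_of_home hj
  ext ⟨τ, i, m⟩
  constructor
  · rintro ⟨r, ⟨t, d, ⟨b', hl, hm⟩, hd, rfl⟩, hτ⟩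
    dsimp only at hl hm hd hτ
    have hd' : C.splitDelay b₀ i j = d := WithTop.coe_injective hd
    have h0 := (C.clock_nonneg i).trans (hS.clock_le hm)
    have hoff := C.half_le_off b' b j
    rw [hstart] at hτ
    have hlink : b' = b ∨ (C.home i = some b' ∧ C.home j = some b) := by
      rcases hi : C.home i with _ | c
      · left
        by_contra hne
        refine hl ?_ hi
        rw [hj]
        cases b' <;> cases b <;> simp_all
      · exact Or.inr ⟨by rw [hS.eq_of_home hm hi], hj⟩
    have hdel : d = C.off b' b j + C.shift b₀ b - C.shift b₀ b' := by
      rw [← hd', splitDelay]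
      rcases hi : C.home i with _ | c
      · have : b' = b := by simpa [hi] using hlink
        subst this
        simp [off]
      · obtain rfl := hS.eq_of_home hm hi
        simp [hj]
    rw [max_eq_right (by linarith)] at hτ
    refine ⟨b', hlink, ?_⟩
    dsimp only
    rwa [show τ + C.clock j - C.off b' b j = t - C.shift b₀ b' by rw [hτ, hclock, hdel]; ring]
  · intro hx
    have hd := hS.delivered b₀ (by simp [hj]) hx
    refine ⟨_, hd, ?_⟩
    obtain ⟨b', -, hm⟩ := hx
    have h0 := (C.clock_nonneg i).trans (hS.clock_le hm)
    have hoff := C.half_le_off b' b j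
    dsimp only at h0 ⊢
    rw [hstart, hclock, max_eq_right] <;> linarith

theorem inputOf_of_home {E : Run n V D} {i : Fin n} {b b' : Bool} (h : C.home i = some b) :
    E.inputOf L i = C.inp i b' := by
  rw [C.inp_of_home h]
  refine if_neg ?_
  rintro rfl
  simp [C.home_broadcaster] at h

theorem IsSplit.isExecution (hS : C.IsSplit P S) (b₀ : Bool) :
    IsExecution P L f Δ (δ / 2) (C.splitRun S b₀) := by
  have h2 := C.two_mul_lt
  have hδ := C.pos
  have hδΔ := C.le
  refine ⟨?_, ?_, ?_, ?_, ?_, ?_, ?_⟩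
  · have hsub : (C.splitRun S b₀).honestᶜ ⊆
        insert (C.apex (!b₀)) (Finset.univ.filter fun i => C.home i = none) := by
      intro i hi
      simp only [Finset.mem_compl, mem_honest_splitRun] at hi
      simp only [Finset.mem_insert, Finset.mem_filter, Finset.mem_univ, true_and]
      tauto
    exact (Finset.card_le_card hsub).trans ((Finset.card_insert_le _ _).trans C.card_none)
  · intro i _
    simp only [splitRun]
    rcases C.home i with _ | b
    · exact le_rfl
    · have := C.shift_nonneg b₀ b
      simp only [Option.elim]
      linarith
  · intro i hi j hj
    obtain ⟨b, hb⟩ := Option.ne_none_iff_exists'.1 (C.mem_honest_splitRun.1 hi).1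
    obtain ⟨b', hb'⟩ := Option.ne_none_iff_exists'.1 (C.mem_honest_splitRun.1 hj).1
    have := C.shift_nonneg b₀ b
    have := C.shift_nonneg b₀ b'
    have := C.shift_le b₀ b
    have := C.shift_le b₀ b'
    simp only [splitRun, hb, hb', Option.elim]
    rw [abs_le]
    constructor <;> linarith
  · intro i _ j hj t m
    exact WithTop.coe_le_coe.2 (C.splitDelay_le (C.mem_honest_splitRun.1 hj).2)
  · exact ⟨_, lt_min hδ (by linarith : 0 < Δ - 2 * s),
      fun i t j m => WithTop.coe_le_coe.2 (C.le_splitDelay b₀ i j)⟩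
  · intro i hi t j m
    obtain ⟨b, hb⟩ := Option.ne_none_iff_exists'.1 (C.mem_honest_splitRun.1 hi).1
    have hclock := C.clock_of_home hb
    have hstart : (C.splitRun S b₀).start i = δ / 2 + C.shift b₀ b := by simp [splitRun, hb]
    have e : t - C.shift b₀ b - δ / 2 = t - (δ / 2 + C.shift b₀ b) := by ring
    have hsent : m ∈ (C.splitRun S b₀).sent i t j ↔ m ∈ S (t - C.shift b₀ b) i b j := by
      constructor
      · rintro ⟨b', -, hm⟩
        obtain rfl := hS.eq_of_home hm hb
        exact hm
      · exact fun hm => ⟨b, fun _ => by simp [hb], hm⟩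
    rw [hsent, hS, hS.view_splitRun b₀ hb, inputOf_of_home (b' := b) hb, hstart, hclock, e]
    constructor
    · rintro ⟨-, h, hm⟩
      exact ⟨by linarith, hm⟩
    · rintro ⟨h, hm⟩
      exact ⟨by simp [hb], by linarith, hm⟩
  · rintro i hi t j m ⟨b, -, hm⟩
    obtain ⟨ha, hc, hm'⟩ := (hS ..).1 hm
    have := C.clock_nonneg i
    have := C.shift_nonneg b₀ b
    refine ⟨by linarith, fun k hk x hx => ?_⟩
    -- Byzantine parties only run copies of the protocol here, so any foreign signature they use was
    -- received by that copy.
    obtain ⟨y, ⟨hy, hyt⟩, hyc⟩ := P.no_forgery _ _ _ _ _ m hm' k x (by rintro rfl; exact hi hk) hx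
    exact ⟨i, hi, _, _, _, hS.delivered b₀ ha hy, by linarith, hyc⟩

/-- The commits of an honest party of side `b`, in the time of its local clock. -/
theorem IsSplit.commitsAt_iff (hS : C.IsSplit P S) (b₀ : Bool) {j : Fin n} {b : Bool}
    (hj : C.home j = some b) (v : V) :
    (∃ t, (C.splitRun S b₀).CommitsAt P L j v t) ↔
      ∃ τ, 0 ≤ τ ∧ P.commit j none τ ((C.splitView S j b).upTo τ) = some v := by
  have hstart : (C.splitRun S b₀).start j = δ / 2 + C.shift b₀ b := by simp [splitRun, hj]
  simp only [Run.CommitsAt, hS.view_splitRun b₀ hj, inputOf_of_home (b' := b) hj,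
    C.inp_of_home hj]
  constructor
  · rintro ⟨t, h, hc⟩
    exact ⟨_, sub_nonneg.2 h, hc⟩
  · rintro ⟨τ, h, hc⟩
    exact ⟨τ + (C.splitRun S b₀).start j, by linarith, by simpa using hc⟩

variable (C)

/-! ### Runs with an honest broadcaster -/

/-- What the Byzantine party `i` of the other side sends in the run with an honest broadcaster: the
messages that it sends as long as it has received nothing. -/
def mute (_ : Scenario n V L f Δ δ s) (P : Protocol n V D) (t : ℝ) (i j : Fin n) :
    Set (Msg n D) :=
  {m | δ / 2 ≤ t ∧ t < δ ∧ m ∈ P.send i none (t - δ / 2) ∅ j}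

/-- The view of `j` in the run with an honest broadcaster in which side `b` is honest, if the
honest parties `i` send `R t i j` to `j`. -/
def goodView (P : Protocol n V D) (b : Bool) (R : ℝ → Fin n → Fin n → Set (Msg n D))
    (j : Fin n) : View n D :=
  {x | (C.home x.2.1 ≠ some (!b) ∧ x.2.2 ∈ R (x.1 + C.clock j - δ) x.2.1 j) ∨
    (C.home x.2.1 = some (!b) ∧ C.home j = some b ∧
      x.2.2 ∈ C.mute P (x.1 + C.clock j - C.lag j) x.2.1 j)}

/-- All parties but those of the other side follow the protocol. -/
def IsGood (P : Protocol n V D) (b : Bool) (R : ℝ → Fin n → Fin n → Set (Msg n D)) : Prop :=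
  ∀ t i j m, m ∈ R t i j ↔ C.clock i ≤ t ∧
    m ∈ P.send i (C.inp i b) (t - C.clock i) ((C.goodView P b R i).upTo (t - C.clock i)) j

theorem exists_isGood (P : Protocol n V D) (b : Bool) : ∃ R, C.IsGood P b R := by
  have hpos := C.pos
  obtain ⟨R, hR⟩ := exists_eq_of_causal (X := Fin n → Fin n → Set (Msg n D))
    hpos (fun R t i j => {m | C.clock i ≤ t ∧
      m ∈ P.send i (C.inp i b) (t - C.clock i) ((C.goodView P b R i).upTo (t - C.clock i)) j})
    (by
      intro R R' t ht
      funext i j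
      have := C.clock_nonneg i
      ext m
      simp only [Set.mem_ofPred_eq]
      constructor <;> rintro ⟨h, -⟩ <;> linarith)
    (by
      intro R R' t h
      funext i j
      have : (C.goodView P b R i).upTo (t - C.clock i) =
          (C.goodView P b R' i).upTo (t - C.clock i) := by
        ext ⟨τ, k, m⟩
        refine and_congr_left fun hτ => or_congr_left (and_congr_right fun _ => ?_)
        dsimp only at hτ ⊢
        rw [h _ (by linarith)]
      simp only [this])
  exact ⟨R, fun t i j m => by rw [hR t]; rfl⟩

/-- The run with an honest broadcaster in which the parties of side `!b` are Byzantine. -/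
noncomputable def goodRun (P : Protocol n V D) (b : Bool)
    (R : ℝ → Fin n → Fin n → Set (Msg n D)) : Run n V D where
  honest := Finset.univ.filter fun i => C.home i ≠ some (!b)
  input := C.val b
  start := C.clock
  sent i t j := if C.home i = some (!b) then C.mute P t i j else R t i j
  delay i _ j _ := if C.home i = some (!b) then
    if C.home j = some b then (C.lag j : ℝ) else ⊤ else (δ : ℝ)

variable {C} {P : Protocol n V D} {b : Bool} {R : ℝ → Fin n → Fin n → Set (Msg n D)}
  {S : ℝ → Fin n → Bool → Fin n → Set (Msg n D)}

theorem mem_honest_goodRun {i : Fin n} :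
    i ∈ (C.goodRun P b R).honest ↔ C.home i ≠ some (!b) := by
  simp [goodRun]

theorem inputOf_goodRun (i : Fin n) : (C.goodRun P b R).inputOf L i = C.inp i b := rfl

theorem IsGood.view_goodRun (hR : C.IsGood P b R) (j : Fin n) :
    (C.goodRun P b R).view j = C.goodView P b R j := by
  have hδ := C.pos; have hle := C.le; have h2 := C.two_mul_lt; have hl := C.le_lag j
  have hc := C.clock_le j
  ext ⟨τ, i, m⟩
  simp only [Run.view, Run.Delivered, goodRun, goodView, Set.mem_ofPred_eq]
  by_cases hi : C.home i = some (!b)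
  · simp only [hi, if_true, ne_eq, not_true, false_and, false_or, true_and]
    constructor
    · rintro ⟨r, ⟨t, d, hm, hd, rfl⟩, hτ⟩
      by_cases hj : C.home j = some b
      · rw [if_pos hj] at hd
        obtain rfl : C.lag j = d := WithTop.coe_injective hd
        have := hm.1
        rw [max_eq_right (by linarith)] at hτ
        refine ⟨hj, ?_⟩
        rwa [show τ + C.clock j - C.lag j = t by rw [hτ]; ring]
      · rw [if_neg hj] at hd
        exact absurd hd (WithTop.coe_ne_top).symm
    · rintro ⟨hj, hm⟩
      have := hm.1
      refine ⟨_, ⟨_, C.lag j, hm, by rw [if_pos hj], rfl⟩, ?_⟩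
      rw [max_eq_right (by linarith)]
      ring
  · simp only [hi, if_false, ne_eq, not_false_eq_true, true_and, false_and, or_false]
    constructor
    · rintro ⟨r, ⟨t, d, hm, hd, rfl⟩, hτ⟩
      obtain rfl : δ = d := WithTop.coe_injective hd
      have := ((hR ..).1 hm).1
      have := C.clock_nonneg i
      rw [max_eq_right (by linarith)] at hτ
      rwa [show τ + C.clock j - δ = t by rw [hτ]; ring]
    · intro hm
      have := ((hR ..).1 hm).1
      have := C.clock_nonneg i
      refine ⟨_, ⟨_, δ, hm, rfl, rfl⟩, ?_⟩
      rw [max_eq_right (by linarith)]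
      ring

/-- The bound `d` is left free: `d = δ` serves the good-case latency, `d = Δ` validity and
agreement. -/
theorem IsGood.isExecution (hR : C.IsGood P b R) {d : ℝ} (hd : δ ≤ d) :
    IsExecution P L f d (δ / 2) (C.goodRun P b R) := by
  have h2 := C.two_mul_lt
  have hδ := C.pos
  have hδΔ := C.le
  refine ⟨?_, fun i _ => C.clock_nonneg i, ?_, ?_, ?_, ?_, ?_⟩
  · have : (C.goodRun P b R).honestᶜ = Finset.univ.filter fun i => C.home i = some (!b) := by
      ext i
      simp [mem_honest_goodRun]
    rw [this]
    exact C.card_side _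
  · intro i _ j _
    have := C.clock_nonneg i
    have := C.clock_nonneg j
    have := C.clock_le i
    have := C.clock_le j
    simp only [goodRun]
    rw [abs_le]
    constructor <;> linarith
  · intro i hi j _ t m
    simp only [goodRun, if_neg (mem_honest_goodRun.1 hi)]
    exact WithTop.coe_le_coe.2 hd
  · refine ⟨δ / 2, half_pos hδ, fun i t j m => ?_⟩
    have := C.le_lag j
    simp only [goodRun]
    split_ifs
    · exact WithTop.coe_le_coe.2 (by linarith)
    · exact le_top
    · exact WithTop.coe_le_coe.2 (by linarith)
  · intro i hi t j m
    rw [hR.view_goodRun, inputOf_goodRun]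
    simp only [goodRun, if_neg (mem_honest_goodRun.1 hi)]
    exact hR t i j m
  · intro i hi t j m hm
    have hi' : C.home i = some (!b) := by simpa [mem_honest_goodRun] using hi
    simp only [goodRun, if_pos hi'] at hm
    refine ⟨by linarith [hm.1], fun k hk x hx => ?_⟩
    -- Messages computed from the empty view carry no foreign signature.
    obtain ⟨y, hy, -⟩ := P.no_forgery _ _ _ _ _ m hm.2.2 k x (by rintro rfl; exact hi hk) hx
    exact absurd hy (Set.notMem_empty y)

/-! ### Indistinguishability of split and good runs -/

/-- Nothing reaches a side before `δ`: messages within it take `δ`, and those across leave no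
earlier than `δ / 2` and take at least `Δ - s > δ / 2`. The latter is why all but the broadcaster
start at `δ / 2`. -/
theorem IsSplit.send_of_lt (hS : C.IsSplit P S) {t : ℝ} (ht : t < δ) {i : Fin n}
    (hi : C.home i = some b) (j : Fin n) : S t i b j = C.mute P t i j := by
  have h2 := C.two_mul_lt; have hle := C.le
  have hempty : (C.splitView S i b).upTo (t - C.clock i) = ∅ := by
    rw [Set.eq_empty_iff_forall_notMem]
    rintro ⟨τ, k, m⟩ ⟨⟨b', hb, hm⟩, hτ⟩
    dsimp only at hb hm hτ
    have hc := hS.clock_le hm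
    by_cases hbb : b' = b
    · have := C.clock_nonneg k
      rw [off, if_pos hbb] at hc
      linarith
    replace hb := hb.resolve_left hbb
    rw [C.clock_of_home hb.1, off, if_neg hbb] at hc
    have := C.le_lag i
    linarith
  ext m
  rw [hS, hempty, C.inp_of_home hi, C.clock_of_home hi]
  simp only [mute, Set.mem_ofPred_eq, hi]
  constructor
  · rintro ⟨-, h⟩
    exact ⟨h.1, ht, h.2⟩
  · rintro ⟨h, -, h'⟩
    exact ⟨by simp, h, h'⟩

/-- Messages from the other side received before `lag i + δ` were sent before `δ`, hence are those
that the Byzantine side imitates without knowing anything. -/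
theorem IsSplit.upTo_eq (hS : C.IsSplit P S) {i : Fin n}
    (hi : C.home i ≠ some (!b)) {t : ℝ} (ht : t < C.lag i + δ)
    (h : ∀ k, C.home k ≠ some (!b) → ∀ t' ≤ t - δ, S t' k b i = R t' k i) :
    (C.splitView S i b).upTo (t - C.clock i) = (C.goodView P b R i).upTo (t - C.clock i) := by
  ext ⟨τ, k, m⟩
  refine and_congr_left fun hτ => ?_
  dsimp only at hτ
  simp only [splitView, goodView, Set.mem_ofPred_eq]
  by_cases hk : C.home k = some (!b)
  · simp only [hk, ne_eq, not_true, false_and, false_or, true_and]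
    constructor
    · rintro ⟨b', hb, hm⟩
      obtain rfl := hS.eq_of_home hm hk
      rcases hb with hb | ⟨-, hb⟩
      · simp at hb
      · rw [hS.send_of_lt (by simp [off]; linarith) hk] at hm
        exact ⟨hb, by simpa [off] using hm⟩
    · rintro ⟨hb, hm⟩
      refine ⟨!b, Or.inr ⟨rfl, hb⟩, ?_⟩
      rw [hS.send_of_lt (by simp [off]; linarith) hk]
      simpa [off] using hm
  · simp only [hk, ne_eq, not_false_eq_true, true_and, false_and, or_false]
    rw [← h k hk _ (by linarith)]
    constructor
    · rintro ⟨b', hb, hm⟩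
      have : b' = b := by
        rcases hb with hb | hb
        · exact hb
        · rw [hb.1] at hk
          cases b' <;> cases b <;> simp_all
      subst this
      simpa [off] using hm
    · exact fun hm => ⟨b, Or.inl rfl, by simpa [off] using hm⟩

theorem IsSplit.eq_isGood (hS : C.IsSplit P S) (hR : C.IsGood P b R) (N : ℕ) :
    ∀ t < N * δ, ∀ i, C.home i ≠ some (!b) → t < C.lag i + δ → ∀ j, S t i b j = R t i j := by
  have h2 := C.two_mul_lt; have hδ := C.pos
  induction N with
  | zero =>
    intro t ht i hi _ j
    have := C.clock_nonneg i
    ext m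
    rw [hS, hR]
    simp only [Nat.cast_zero, zero_mul] at ht
    constructor
    · rintro ⟨-, h, -⟩
      linarith
    · rintro ⟨h, -⟩
      linarith
  | succ N ih =>
    intro t ht i hi hti j
    have : (C.splitView S i b).upTo (t - C.clock i) =
        (C.goodView P b R i).upTo (t - C.clock i) := by
      -- News that reached `k` through a shorter lag is relayed too late: `t' ≤ t - δ < lag i ≤ Δ +
      -- s < Δ - s + δ ≤ lag k + δ`. This is where `2 * s < δ` is needed.
      refine hS.upTo_eq hi hti fun k hk t' ht' => ih t' ?_ k hk ?_ i
      · push_cast at ht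
        linarith
      · have := C.lag_le i
        have := C.le_lag k
        linarith
    ext m
    rw [hS, hR, this]
    simp [hi]

theorem IsSplit.upTo_eq_isGood (hS : C.IsSplit P S) (hR : C.IsGood P b R) {i : Fin n}
    (hi : C.home i ≠ some (!b)) {t : ℝ} (ht : t < C.lag i + δ) :
    (C.splitView S i b).upTo (t - C.clock i) = (C.goodView P b R i).upTo (t - C.clock i) := by
  have h2 := C.two_mul_lt
  refine hS.upTo_eq hi ht fun k hk t' ht' => ?_
  obtain ⟨N, hN⟩ := exists_nat_gt (t' / δ)
  refine hS.eq_isGood hR N t' ((div_lt_iff₀ C.pos).1 hN) k hk ?_ i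
  have := C.lag_le i
  have := C.le_lag k
  linarith

/-- The distinguished party of side `b` commits the value of its side in every split run. -/
theorem IsSplit.apex_commitsAt (hS : C.IsSplit P S) {T : ℝ} (hTs : T < Δ + δ + s)
    (hP : IsReliableBroadcast P L f Δ (δ / 2)) (hT : HasGoodCaseLatency P L f δ (δ / 2) T)
    (b b₀ : Bool) : ∃ t, (C.splitRun S b₀).CommitsAt P L (C.apex b) (C.val b) t := by
  obtain ⟨R, hR⟩ := C.exists_isGood P b
  have ha := C.home_apex b
  have hi : C.home (C.apex b) ≠ some (!b) := by simp [ha]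
  have hL : L ∈ (C.goodRun P b R).honest := by simp [mem_honest_goodRun, C.home_broadcaster]
  have hmem := mem_honest_goodRun (P := P) (R := R).2 hi
  obtain ⟨w, t, hw, ht⟩ := hT _ (hR.isExecution le_rfl) hL _ hmem
  obtain ⟨t', ht'⟩ := hP.validity _ (hR.isExecution C.le) hL _ hmem
  -- Good-case latency does not say which value is committed; validity and agreement do.
  obtain rfl : w = C.val b := hP.agreement _ (hR.isExecution C.le) _ hmem _ hmem _ _ _ _ hw ht'
  obtain ⟨h0, hc⟩ := hw
  rw [hR.view_goodRun, inputOf_goodRun, C.inp_of_home ha] at hc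
  have hst : (C.goodRun P b R).start = C.clock := rfl
  rw [hst] at h0 hc ht
  have hclock : C.clock L = 0 := if_pos rfl
  rw [← hS.upTo_eq_isGood hR hi (by rw [C.lag_apex]; linarith)] at hc
  exact (hS.commitsAt_iff b₀ ha _).2 ⟨_, sub_nonneg.2 h0, hc⟩

theorem le_latency (C : Scenario n V L f Δ δ s) {T : ℝ} {c : Fin n} {b : Bool}
    (hc : C.home c = some b) (hca : c ≠ C.apex b) (hval : C.val false ≠ C.val true)
    (hP : IsReliableBroadcast P L f Δ (δ / 2)) (hT : HasGoodCaseLatency P L f δ (δ / 2) T) :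
    Δ + δ + s ≤ T := by
  by_contra! hTs
  obtain ⟨S, hS⟩ := C.exists_isSplit P
  have hcmem : ∀ b₀, c ∈ (C.splitRun S b₀).honest := by
    intro b₀
    rw [mem_honest_splitRun]
    refine ⟨by simp [hc], ?_⟩
    rintro rfl
    rw [C.home_apex, Option.some_inj] at hc
    exact hca (by rw [hc])
  have key : ∀ b₀, ∃ t, (C.splitRun S b₀).CommitsAt P L c (C.val b₀) t := by
    intro b₀
    have hmem : C.apex b₀ ∈ (C.splitRun S b₀).honest := by
      rw [mem_honest_splitRun]
      refine ⟨by simp [C.home_apex], fun h => ?_⟩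
      have := congrArg C.home h
      simp [C.home_apex] at this
    obtain ⟨t, ht⟩ := hS.apex_commitsAt hTs hP hT b₀ b₀
    obtain ⟨w, t', ht'⟩ := hP.termination _ (hS.isExecution b₀) ⟨_, hmem, _, _, ht⟩ c (hcmem b₀)
    obtain rfl := hP.agreement _ (hS.isExecution b₀) _ hmem _ (hcmem b₀) _ _ _ _ ht ht'
    exact ⟨t', ht'⟩
  obtain ⟨t, ht⟩ := key false
  -- The commit of `c` is transported between the two executions through its local view.
  obtain ⟨t', ht'⟩ := (hS.commitsAt_iff false hc _).2 ((hS.commitsAt_iff true hc _).1 (key true))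
  exact hval (hP.agreement _ (hS.isExecution false) _ (hcmem _) _ (hcmem _) _ _ _ _ ht ht')

end Scenario

/-! ### Partition of the parties and conclusion -/

/-- The parties can be divided into the two-faced ones and the two sides. -/
theorem exists_home {n f : ℕ} (hn : 4 ≤ n) (hf : n < 3 * f) (L : Fin n) :
    ∃ (home : Fin n → Option Bool) (apex : Bool → Fin n) (c : Fin n), home L = none ∧
      (∀ b, home (apex b) = some b) ∧ home c = some true ∧ c ≠ apex true ∧
      (Finset.univ.filter fun i => home i = none).card + 1 ≤ f ∧
      ∀ b, (Finset.univ.filter fun i => home i = some b).card ≤ f := by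
  obtain ⟨T, hT, hT3⟩ := Finset.exists_subset_card_eq
    (s := Finset.univ.erase L) (n := 3) (by simp; omega)
  obtain ⟨x, y, c, hxy, hxc, hyc, rfl⟩ := Finset.card_eq_three.1 hT3
  have hne : x ≠ L ∧ y ≠ L ∧ c ≠ L := by
    simpa [Finset.insert_subset_iff] using hT
  set Q : Finset (Fin n) := {L, x, y, c} with hQ
  have hQc : Q.card = 4 := by
    rw [hQ, Finset.card_insert_of_notMem, hT3]
    simp [hne.1.symm, hne.2.1.symm, hne.2.2.symm]
  have hR : Qᶜ.card = n - 4 := by rw [Finset.card_compl, hQc, Fintype.card_fin]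
  -- Here `f ≥ 2`. Beyond `L, x, y, c`, there is room for `f - 2` parties with `y, c`, for `f - 1`
  -- with `x` and for `f - 2` with `L`, which suffices as `n - 4 ≤ 3 * f - 5`.
  obtain ⟨B, hB, hBc⟩ := Finset.exists_subset_card_eq
    (s := Qᶜ) (n := min (f - 2) (n - 4)) (by omega)
  have hR' : (Qᶜ \ B).card = n - 4 - min (f - 2) (n - 4) := by
    rw [Finset.card_sdiff_of_subset hB, hR, hBc]
  obtain ⟨A, hA, hAc⟩ := Finset.exists_subset_card_eq
    (s := Qᶜ \ B) (n := min (f - 1) (n - 4 - min (f - 2) (n - 4))) (by omega)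
  have hF : ((Qᶜ \ B) \ A).card = _ := Finset.card_sdiff_of_subset hA
  have hBQ : ∀ i ∈ B, i ≠ L ∧ i ≠ x ∧ i ≠ y ∧ i ≠ c := fun i hi => by
    simpa [hQ] using hB hi
  have hAQ : ∀ i ∈ A, (i ≠ L ∧ i ≠ x ∧ i ≠ y ∧ i ≠ c) ∧ i ∉ B := fun i hi => by
    simpa [hQ] using hA hi
  have hLB : L ∉ B := fun h => (hBQ L h).1 rfl
  have hLA : L ∉ A := fun h => (hAQ L h).1.1 rfl
  have hxB : x ∉ B := fun h => (hBQ x h).2.1 rfl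
  obtain ⟨home, hhome⟩ : ∃ home : Fin n → Option Bool, ∀ i, home i =
      if i = y ∨ i = c ∨ i ∈ B then some true else
        if i = x ∨ i ∈ A then some false else none := ⟨_, fun _ => rfl⟩
  refine ⟨home, fun b => if b then y else x, c,
    ?_, ?_, ?_, ?_, ?_, ?_⟩
  · simp [hhome, hne.1.symm, hne.2.1.symm, hne.2.2.symm, hLB, hLA]
  · rintro (_ | _)
    · simp [hhome, hxy, hxc, hxB]
    · simp [hhome]
  · simp [hhome]
  · simpa using hyc.symm
  · have : (Finset.univ.filter fun i => home i = none) ⊆ insert L ((Qᶜ \ B) \ A) := by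
      intro i hi
      simp only [Finset.mem_filter, Finset.mem_univ, true_and, hhome] at hi
      split_ifs at hi with h1 h2
      simp only [hQ, Finset.mem_insert, Finset.mem_sdiff, Finset.mem_compl, Finset.mem_singleton]
      tauto
    have := (Finset.card_le_card this).trans (Finset.card_insert_le _ _)
    omega
  · rintro (_ | _)
    · have : (Finset.univ.filter fun i => home i = some false) ⊆ insert x A := by
        intro i hi
        simp only [Finset.mem_filter, Finset.mem_univ, true_and, hhome] at hi
        split_ifs at hi with h1 h2
        · simp at hi
        · simpa using h2
      have := (Finset.card_le_card this).trans (Finset.card_insert_le _ _)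
      omega
    · have : (Finset.univ.filter fun i => home i = some true) ⊆ insert y (insert c B) := by
        intro i hi
        simp only [Finset.mem_filter, Finset.mem_univ, true_and, hhome] at hi
        split_ifs at hi with h1 h2
        · simpa using h1
        · simp at hi
      have := (Finset.card_le_card this).trans ((Finset.card_insert_le _ _).trans
        (Nat.succ_le_succ (Finset.card_insert_le _ _)))
      omega

end BRB

theorem mainTheorem3 {V D : Type*} [Nontrivial V] (n f : ℕ) (hn : 4 ≤ n) (hf : (n : ℝ) / 3 < f)
    (L : Fin n) (Δ δ : ℝ) (hδ : 0 < δ) (hδΔ : δ ≤ Δ) (P : BRB.Protocol n V D)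
    (hP : BRB.IsReliableBroadcast P L f Δ (δ / 2))
    (T : ℝ) (hT : BRB.HasGoodCaseLatency P L f δ (δ / 2) T) :
    Δ + 3 / 2 * δ ≤ T := by
  have hf' : n < 3 * f := by
    have : (n : ℝ) < 3 * f := by linarith
    exact_mod_cast this
  obtain ⟨home, apex, c, hL, hapex, hc, hca, hnone, hside⟩ := BRB.exists_home hn hf' L
  obtain ⟨v, w, hvw⟩ := exists_pair_ne V
  by_contra! hlt
  -- The value `s = δ / 2` itself is excluded by `2 * s < δ`; any `s` below it with `T < Δ + δ + s`
  -- gives the contradiction.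
  obtain ⟨s, hs, hs'⟩ := exists_between
    (max_lt (half_pos hδ) (by linarith) : max 0 (T - Δ - δ) < δ / 2)
  let C : BRB.Scenario n V L f Δ δ s :=
    { home := home
      apex := apex
      val := fun b => if b then w else v
      home_broadcaster := hL
      home_apex := hapex
      card_none := hnone
      card_side := hside
      pos := hδ
      le := hδΔ
      nonneg := (le_max_left _ _).trans hs.le
      two_mul_lt := by linarith }
  have := C.le_latency hc hca (by simpa [C] using hvw) hP hT
  linarith [(le_max_right _ _).trans_lt hs]
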